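/- Machines are deterministic multi-tape Turing machines over the alphabet $\{0,1,\text{blank}\}$ with an input tape, a coin tape and a write-only output; $M^{t}(y;r)$ is the output of $M$ on input $y$ and coins $r$ if $M$ halts within $t$ steps (undefined otherwise). Fix a universal machine $U$ with polynomial slowdown $t_0$, where $t_0(s)\ge s$ for all $s$: for every machine $M$ there is a program $w$ such that for all strings $y,r,x$ and all $s$ with $|w|\le |y|+s$, if $M^{s}(y;r)=x$ then $U^{t_0(|y|+s)}(y;wr)=x$. All polynomials have coefficients in $\mathbb N$. Let $\mathsf{QU}^t(c)$ be the random variable obtained by reading $c\in\{0,1\}^*$ as the code of a quantum circuit of depth at most $t$ over the gate set $\{H,T,\mathrm{CNOT}\}$, running it on $|0\cdots 0\rangle$ and measuring its output qubits in the computational basis (no string is output if $c$ is not such a code). Define $$uK^t(x|y)=-\log_2\Pr_{r\leftarrow\{0,1\}^t}[U^t(y;r)=x],\qquad quK^t(x|1^n)=-\log_2\Pr_{\Pi\leftarrow\{0,1\}^t}\bigl[x\leftarrow \mathsf{QU}^t(U^t(1^n;\Pi))\bigr],$$ with $-\log_2 0=+\infty$. A quantum algorithm of running time $T(n)$ consists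 of a deterministic machine that on input $1^n$ computes within $T(n)$ steps the code $c_n$ of a quantum circuit of depth at most $T(n)$; its output is $\mathsf{QU}^{T(n)}(c_n)$. It is QPT if $T$ is a polynomial. A strong quantum advantage sampler (strong QAS) is a QPT algorithm $\mathcal D_Q$ that on $1^n$ outputs strings in $\{0,1\}^{m(n)}$, for a polynomial $m$, such that for every PPT algorithm $\mathcal D_C$ that on $1^n$ outputs strings in $\{0,1\}^{m(n)}$, the statistical distance satisfies $\Delta(\mathcal D_Q(1^n),\mathcal D_C(1^n))\ge 1-\mathrm{negl}(n)$. (A PPT algorithm is a machine run with polynomially many uniformly random coins that always halts within polynomially many steps.) **Lemma.** Let $\mathcal D_Q$ be a strong QAS with polynomial running time $T(n)$, let $c$ be a constant, and let $t$ be a polynomial with $t(n)\ge t_0(n+T(n))$ for all $n$. Then there is a function $f(n)=\omega(\log n)$ such that for all sufficiently large $n$, with probability at least $1-n^{-c}$ over $x\leftarrow\mathcal D_Q(1^n)$, $$quK^{t(n)}(x|1^n)+f(n)\le uK^{t(n)}(x|1^n).$$ -/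

import Mathlib

open Filter

/-! ## Turing machines with an input tape, a coin tape and a write-only output -/

/-- A two-way infinite tape over `{0, 1, blank}` (`none` is the blank) with a head. -/
structure TMTape where
  cells : ℤ → Option Bool
  head : ℤ

namespace TMTape

/-- The string `l` written on the cells `0, 1, …, |l| - 1`, with the head on cell `0`. -/
def ofList (l : List Bool) : TMTape where
  cells := fun z => if 0 ≤ z then l[z.toNat]? else none
  head := 0

/-- The scanned symbol. -/
def read (τ : TMTape) : Option Bool := τ.cells τ.head

/-- Overwrite the scanned cell by `a.1`, then move the head by `a.2 ∈ {-1, 0, 1}`. -/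
def act (τ : TMTape) (a : Option Bool × SignType) : TMTape where
  cells := Function.update τ.cells τ.head a.1
  head := τ.head + (a.2 : ℤ)

end TMTape

/-- The tapes of a machine: the input tape, the coin tape, and one tape for each `w : W`. -/
inductive TapeIx (W : Type) : Type
  | input : TapeIx W
  | coin : TapeIx W
  | work (w : W) : TapeIx W

/-- A deterministic multi-tape Turing machine.  Depending on the state and the scanned symbols, a
transition either halts (`none`), or it gives the next state, the symbol to write and the head move
on every tape, and possibly one bit to append to the output. Probabilistic computations are obtained
by writing uniformly random bits on the coin tape. -/
structure TM where
  State : Type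
  Work : Type
  finState : Finite State
  finWork : Finite Work
  start : State
  δ : State → (TapeIx Work → Option Bool) →
    Option (State × (TapeIx Work → Option Bool × SignType) × Option Bool)

namespace TM

/-- A configuration: state, tapes, and the output written so far. -/
structure Cfg (M : TM) where
  state : M.State
  tape : TapeIx M.Work → TMTape
  out : List Bool

/-- The transition that applies in a configuration (`none` if the machine has halted). -/
def transition (M : TM) (a : M.Cfg) :
    Option (M.State × (TapeIx M.Work → Option Bool × SignType) × Option Bool) :=
  M.δ a.state fun i => (a.tape i).read

/-- One step of computation; a halted configuration does not change. -/
def step (M : TM) (a : M.Cfg) : M.Cfg :=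
  match M.transition a with
  | none => a
  | some (q, acts, o) =>
    { state := q, tape := fun i => (a.tape i).act (acts i), out := a.out ++ o.toList }

/-- The initial configuration on input `y` and coins `r`. -/
def initial (M : TM) (y r : List Bool) : M.Cfg where
  state := M.start
  tape := fun i =>
    match i with
    | TapeIx.input => TMTape.ofList y
    | TapeIx.coin => TMTape.ofList r
    | TapeIx.work _ => TMTape.ofList []
  out := []

/-- `M^t(y; r)`: the output of `M` on input `y` and coins `r` if `M` halts within `t` steps, and
`none` otherwise. -/
def eval (M : TM) (t : ℕ) (y r : List Bool) : Option (List Bool) :=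
  let a := M.step^[t] (M.initial y r)
  if (M.transition a).isNone then some a.out else none

end TM

/-- The string `1^n`. -/
def ones (n : ℕ) : List Bool := List.replicate n true

/-- `U` is a universal Turing machine that simulates with the polynomial slowdown `t₀`: every
machine `M` has a program `w` such that `U` with `w` in front of the coins `r` gives the same output
as `M` with coins `r`. If `M` takes at most `s` steps on input `y`, then `U` takes at most
`t₀(|y| + s)` steps, as soon as `|y| + s` is at least the length of the program. -/
def TM.IsUniversal (U : TM) (t₀ : Polynomial ℕ) : Prop :=
  (∀ s : ℕ, s ≤ t₀.eval s) ∧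
  ∀ M : TM, ∃ w : List Bool, ∀ (y r x : List Bool) (s : ℕ), w.length ≤ y.length + s →
    M.eval s y r = some x → U.eval (t₀.eval (y.length + s)) y (w ++ r) = some x

/-! ## Quantum circuits over the gate set `{H, T, CNOT}` -/

/-- A gate on `N` qubits, with the qubits it acts on (`CNOT` has control `i` and target `j`). -/
inductive QGate (N : ℕ) : Type
  | H (i : Fin N) : QGate N
  | T (i : Fin N) : QGate N
  | CNOT (i j : Fin N) (h : i ≠ j) : QGate N

namespace QGate

/-- The action of a gate on a state vector, given by its amplitudes in the computational basis. -/
noncomputable def apply {N : ℕ} (g : QGate N) (ψ : (Fin N → Bool) → ℂ) : (Fin N → Bool) → ℂ :=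
  match g with
  | H i => fun b =>
      (ψ (Function.update b i false) + (if b i then -1 else 1) * ψ (Function.update b i true))
        / (Real.sqrt 2 : ℂ)
  | T i => fun b => (if b i then Complex.exp (Real.pi / 4 * Complex.I) else 1) * ψ b
  | CNOT i j _ => fun b => ψ (Function.update b j (xor (b j) (b i)))

/-- The update of the depths of the wires when the gate is appended. -/
def wireDepth {N : ℕ} (g : QGate N) (d : Fin N → ℕ) : Fin N → ℕ :=
  match g with
  | H i => Function.update d i (d i + 1)
  | T i => Function.update d i (d i + 1)
  | CNOT i j _ =>
      Function.update (Function.update d i (max (d i) (d j) + 1)) j (max (d i) (d j) + 1)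

end QGate

/-- A quantum circuit: `gates` are applied, from the head of the list on, to `qubits` qubits in the
state `|0…0⟩`, and then the first `outBits` qubits are measured in the computational basis. -/
structure QCircuit where
  outBits : ℕ
  qubits : ℕ
  le : outBits ≤ qubits
  gates : List (QGate qubits)

namespace QCircuit

/-- The state before the measurement. -/
noncomputable def finalState (C : QCircuit) : (Fin C.qubits → Bool) → ℂ :=
  C.gates.foldl (fun ψ g => g.apply ψ) fun b => if ∀ i, b i = false then 1 else 0

/-- The probability that the circuit outputs the string `x`. -/
noncomputable def prob (C : QCircuit) (x : List Bool) : ℝ :=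
  ∑ b : Fin C.qubits → Bool,
    if List.ofFn (fun i : Fin C.outBits => b (Fin.castLE C.le i)) = x
      then ‖C.finalState b‖ ^ 2 else 0

/-- The depth of the circuit. -/
def depth (C : QCircuit) : ℕ :=
  Finset.univ.sup (C.gates.foldl (fun d g => g.wireDepth d) fun _ => 0)

/-- The self-delimiting code `1^k 0` of a number. -/
def codeNat (k : ℕ) : List Bool := List.replicate k true ++ [false]

/-- The code of a gate. -/
def codeGate {N : ℕ} : QGate N → List Bool
  | QGate.H i => false :: false :: codeNat i
  | QGate.T i => false :: true :: codeNat i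
  | QGate.CNOT i j _ => true :: (codeNat i ++ codeNat j)

/-- The code of a circuit. -/
def encode (C : QCircuit) : List Bool :=
  codeNat C.outBits ++ (codeNat C.qubits ++ C.gates.flatMap codeGate)

theorem codeNat_append_inj {a b : ℕ} {l l' : List Bool}
    (h : codeNat a ++ l = codeNat b ++ l') : a = b ∧ l = l' := by
  induction a generalizing b with
  | zero =>
    cases b with
    | zero => simpa [codeNat] using h
    | succ b => simp [codeNat, List.replicate_succ] at h
  | succ a ih =>
    cases b with
    | zero => simp [codeNat, List.replicate_succ] at h
    | succ b =>
      have h' : codeNat a ++ l = codeNat b ++ l' := by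
        simpa [codeNat, List.replicate_succ] using h
      obtain ⟨h1, h2⟩ := ih h'
      exact ⟨by rw [h1], h2⟩

theorem codeGate_append_inj {N : ℕ} {g g' : QGate N} {l l' : List Bool}
    (h : codeGate g ++ l = codeGate g' ++ l') : g = g' ∧ l = l' := by
  cases g <;> cases g' <;> simp only [codeGate, List.cons_append, List.append_assoc,
    List.cons.injEq, true_and, false_and, Bool.true_eq_false, Bool.false_eq_true] at h
  · obtain ⟨h1, h2⟩ := codeNat_append_inj h
    exact ⟨by rw [Fin.ext h1], h2⟩
  · obtain ⟨h1, h2⟩ := codeNat_append_inj h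
    exact ⟨by rw [Fin.ext h1], h2⟩
  · obtain ⟨h1, h2⟩ := codeNat_append_inj h
    obtain ⟨h3, h4⟩ := codeNat_append_inj h2
    have h1 := Fin.ext h1
    have h3 := Fin.ext h3
    subst h1 h3
    exact ⟨rfl, h4⟩

theorem codeGates_inj {N : ℕ} (gs gs' : List (QGate N))
    (h : gs.flatMap codeGate = gs'.flatMap codeGate) : gs = gs' := by
  induction gs generalizing gs' with
  | nil =>
    cases gs' with
    | nil => rfl
    | cons g' gs' => cases g' <;> simp [codeGate] at h
  | cons g gs ih =>
    cases gs' with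
    | nil => cases g <;> simp [codeGate] at h
    | cons g' gs' =>
      simp only [List.flatMap_cons] at h
      obtain ⟨h1, h2⟩ := codeGate_append_inj h
      rw [h1, ih gs' h2]

theorem encode_injective : Function.Injective encode := by
  rintro ⟨m, N, hm, gs⟩ ⟨m', N', hm', gs'⟩ h
  simp only [encode] at h
  obtain ⟨h1, h2⟩ := codeNat_append_inj h
  obtain ⟨h3, h4⟩ := codeNat_append_inj h2
  subst h1 h3
  rw [codeGates_inj gs gs' h4]

/-- The circuit with code `c`, if there is one (it is unique, by `encode_injective`). -/
noncomputable def decode : List Bool → Option QCircuit := Function.partialInv encode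

/-- `QU^t`: the probability that `x` is output when `c` is read as the code of a quantum circuit of
depth at most `t` and this circuit is run. If `c` is not such a code, no string is output. -/
noncomputable def runCode (t : ℕ) (c x : List Bool) : ℝ :=
  match decode c with
  | some C => if C.depth ≤ t then C.prob x else 0
  | none => 0

end QCircuit

/-! ## Time-bounded complexities relative to a machine `U` -/

/-- The probability that `M^s(y; r)` outputs `x`, for `r` uniform in `{0,1}^ℓ`. -/
noncomputable def classicalProb (M : TM) (ℓ s : ℕ) (y x : List Bool) : ℝ :=
  (∑ r : Fin ℓ → Bool, if M.eval s y (List.ofFn r) = some x then 1 else 0) / 2 ^ ℓ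

/-- The probability that `x` is output when `c` is computed as `U^t(1^n; Π)` for `Π` uniform in
`{0,1}^t`, and then `QU^t` is run on `c`. -/
noncomputable def universalQuantumProb (U : TM) (t n : ℕ) (x : List Bool) : ℝ :=
  (∑ p : Fin t → Bool,
    match U.eval t (ones n) (List.ofFn p) with
    | some c => QCircuit.runCode t c x
    | none => 0) / 2 ^ t

/-- `-log₂ p` for a probability `p`, with the value `+∞` at `p = 0`. -/
noncomputable def negLogTwo (p : ℝ) : EReal :=
  if p = 0 then ⊤ else ((-Real.logb 2 p : ℝ) : EReal)

/-- `uK^t(x|y)`. -/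
noncomputable def uK (U : TM) (t : ℕ) (x y : List Bool) : EReal :=
  negLogTwo (classicalProb U t t y x)

/-- `quK^t(x|1^n)`. -/
noncomputable def quK (U : TM) (t : ℕ) (x : List Bool) (n : ℕ) : EReal :=
  negLogTwo (universalQuantumProb U t n x)

/-! ## Samplers -/

/-- `D` is the classical part of a quantum algorithm that runs in time `T(n)` on `1^n` and outputs
strings in `{0,1}^{m(n)}`: on `1^n`, and whatever is on its coin tape, `D` computes within `T(n)`
steps the code of a quantum circuit of depth at most `T(n)` with `m(n)` output bits. -/
def IsQuantumSampler (D : TM) (m T : Polynomial ℕ) : Prop :=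
  ∀ n : ℕ, ∃ C : QCircuit, C.outBits = m.eval n ∧ C.depth ≤ T.eval n ∧
    ∀ r : List Bool, D.eval (T.eval n) (ones n) r = some C.encode

/-- The probability that the quantum algorithm with classical part `D` and running time `T`
outputs `x` on `1^n`. -/
noncomputable def quantumProb (D : TM) (T : Polynomial ℕ) (n : ℕ) (x : List Bool) : ℝ :=
  match D.eval (T.eval n) (ones n) [] with
  | some c => QCircuit.runCode (T.eval n) c x
  | none => 0

/-- `A` is a probabilistic algorithm that uses `ℓ(n)` coins and at most `s(n)` steps on `1^n`, and
outputs strings in `{0,1}^{m(n)}`. -/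
def IsPPTSampler (A : TM) (m ℓ s : Polynomial ℕ) : Prop :=
  ∀ (n : ℕ) (r : Fin (ℓ.eval n) → Bool), ∃ x : List Bool, x.length = m.eval n ∧
    A.eval (s.eval n) (ones n) (List.ofFn r) = some x

/-- The statistical distance of two distributions on `{0,1}^k`. -/
noncomputable def statDist (k : ℕ) (P Q : List Bool → ℝ) : ℝ :=
  (1 / 2) * ∑ x : Fin k → Bool, |P (List.ofFn x) - Q (List.ofFn x)|

/-- Negligible functions. -/
def Negligible (ε : ℕ → ℝ) : Prop :=
  ∀ c : ℕ, ∀ᶠ n : ℕ in atTop, ε n < 1 / (n : ℝ) ^ c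

/-- Strong quantum advantage samplers with classical part `D`, output length `m(n)` and running
time `T(n)`: the statistical distance to every PPT algorithm with outputs in `{0,1}^{m(n)}` is at
least `1 - negl(n)`. -/
def IsStrongQAS (D : TM) (m T : Polynomial ℕ) : Prop :=
  IsQuantumSampler D m T ∧
  ∀ (A : TM) (ℓ s : Polynomial ℕ), IsPPTSampler A m ℓ s →
    Negligible fun n => 1 - statDist (m.eval n) (quantumProb D T n)
      (classicalProb A (ℓ.eval n) (s.eval n) (ones n))

/-! ## Tapes -/

/-! Write `P` for the output distribution of the quantum sampler and `Q` for the distribution of `U`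
with `t(n)` coins and `t(n)` steps.

Upper bound on `quK`: the machine `D` that computes the circuit code has a program of some constant
length `L`. A random string begins with it with probability `2^(-L)`, and then the circuit of `D` is
run. So the universal quantum probability of every `x` is at least `P(x) / 2^L`
(`TM.IsUniversal.exists_quantumProb_le`).

Lower bound on `uK`: let `B` be a set of strings with `Q(x) ≥ P(x) / (2^L n^k)`. If `Q` could be
sampled by a PPT algorithm with outputs of length `m(n)`, then `1 - Δ` would be at least `P(B) /
(2^L n^k)` (`mul_sum_le_one_sub_statDist`). As `1 - Δ` is negligible, `P(B) ≤ n^(-c)` for large `n`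
(`IsStrongQAS.eventually_sum_le`). Off the set where `n^k Q(x) > P(x) / 2^L`, the two bounds give a
gap of `k log₂ n`. This holds for each fixed `k` from some point on, so by diagonalization `k` can
be replaced by some `g(n) → ∞`, and `f = g log₂ n`.

Most of the work lies in the PPT sampler, since `U` need not halt in time and its outputs may have
any length. `TM.paddedRun` repairs both. A copy of the coins serves as a clock of `t(n)` ticks,
while `U` works on the original. The length `m(n)` is read off from `D` itself: the code of its
circuit begins with `1^m 0`, where `m` is the number of output bits. `TM.eval_paddedRun` shows that
no output of `U` of the right length is lost. -/

namespace TMTape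

/-- The string `l` written from cell `0` on, with the head on cell `z`. -/
def ofListAt (l : List Bool) (z : ℤ) : TMTape where
  cells := (ofList l).cells
  head := z

theorem ofListAt_zero (l : List Bool) : ofListAt l 0 = ofList l := rfl

theorem read_ofListAt_natCast (l : List Bool) (k : ℕ) : (ofListAt l k).read = l[k]? := by
  simp [read, ofListAt, ofList]

theorem read_ofListAt_neg_one (l : List Bool) : (ofListAt l (-1)).read = none := by
  simp [read, ofListAt, ofList]

theorem act_read (τ : TMTape) (s : SignType) :
    τ.act (τ.read, s) = ⟨τ.cells, τ.head + (s : ℤ)⟩ := by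
  simp [act, read]

theorem act_read_zero (τ : TMTape) : τ.act (τ.read, 0) = τ := by
  simp [act_read]

theorem act_read_ofListAt (l : List Bool) (z : ℤ) (s : SignType) :
    (ofListAt l z).act ((ofListAt l z).read, s) = ofListAt l (z + (s : ℤ)) := by
  rw [act_read]; rfl

theorem act_ofListAt_length (l : List Bool) (b : Bool) :
    (ofListAt l l.length).act (some b, 1) = ofListAt (l ++ [b]) ((l.length + 1 : ℕ) : ℤ) := by
  simp only [act, ofListAt, ofList, SignType.coe_one, Nat.cast_add, Nat.cast_one, mk.injEq,
    and_true]
  funext z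
  rcases lt_trichotomy z l.length with h | rfl | h
  · rw [Function.update_of_ne h.ne]
    split_ifs with h0
    · rw [List.getElem?_append_left (by omega)]
    · rfl
  · simp
  · rw [Function.update_of_ne h.ne']
    rw [if_pos (by omega), if_pos (by omega), List.getElem?_eq_none (by omega),
      List.getElem?_eq_none (by simp; omega)]

/-- The convention for the tape of marks: the head on cell `k - 1` records that `k` output bits are
still due. For `k = 0` it is on the blank cell `-1`. -/
theorem read_marks (m j : ℕ) (h : j < m) :
    (ofListAt (List.replicate m true) (((j + 1 : ℕ) : ℤ) - 1)).read = some true := by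
  have : (((j + 1 : ℕ) : ℤ) - 1) = (j : ℤ) := by push_cast; ring
  rw [this, read_ofListAt_natCast, List.getElem?_replicate, if_pos h]

theorem read_marks_zero (m : ℕ) :
    (ofListAt (List.replicate m true) (((0 : ℕ) : ℤ) - 1)).read = none :=
  read_ofListAt_neg_one _

end TMTape

/-! ## Runs of machines -/

namespace TM

theorem step_of_transition_eq_some {M : TM} {a : M.Cfg} {q : M.State}
    {acts : TapeIx M.Work → Option Bool × SignType} {o : Option Bool}
    (h : M.transition a = some (q, acts, o)) :
    M.step a = ⟨q, fun i => (a.tape i).act (acts i), a.out ++ o.toList⟩ := by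
  simp [step, h]

theorem step_of_transition_eq_none {M : TM} {a : M.Cfg} (h : M.transition a = none) :
    M.step a = a := by
  simp [step, h]

theorem iterate_step_of_halted {M : TM} {a : M.Cfg} (h : M.transition a = none) (k : ℕ) :
    M.step^[k] a = a :=
  Function.iterate_fixed (step_of_transition_eq_none h) k

theorem eval_eq_some_iff {M : TM} {t : ℕ} {y r x : List Bool} :
    M.eval t y r = some x ↔ M.transition (M.step^[t] (M.initial y r)) = none ∧
      (M.step^[t] (M.initial y r)).out = x := by
  simp [eval]

theorem eval_mono {M : TM} {s t : ℕ} (hst : s ≤ t) {y r x : List Bool}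
    (h : M.eval s y r = some x) : M.eval t y r = some x := by
  rw [eval_eq_some_iff] at h ⊢
  obtain ⟨k, rfl⟩ := Nat.exists_eq_add_of_le' hst
  rw [Function.iterate_add_apply, iterate_step_of_halted h.1]
  exact h

theorem out_prefix_step (M : TM) (a : M.Cfg) : a.out <+: (M.step a).out := by
  rcases h : M.transition a with _ | ⟨q, acts, o⟩
  · rw [step_of_transition_eq_none h]
  · rw [step_of_transition_eq_some h]
    exact List.prefix_append _ _

/-- The output tape is write-only, so a partial output already reveals the start of the final one.
This allows `D` to be interrupted at its first `0`. -/
theorem out_prefix_iterate (M : TM) (a : M.Cfg) (k : ℕ) : a.out <+: (M.step^[k] a).out := by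
  induction k with
  | zero => exact List.prefix_rfl
  | succ k ih =>
    rw [Function.iterate_succ_apply']
    exact ih.trans (out_prefix_step M _)

/-- `M` gets from `a` to `b` in at most `K` steps. -/
def Reaches (M : TM) (K : ℕ) (a b : M.Cfg) : Prop := ∃ k ≤ K, M.step^[k] a = b

theorem Reaches.refl {M : TM} (a : M.Cfg) : M.Reaches 0 a a := ⟨0, le_rfl, rfl⟩

theorem Reaches.single {M : TM} {a b : M.Cfg} (h : M.step a = b) : M.Reaches 1 a b :=
  ⟨1, le_rfl, h⟩

theorem Reaches.trans {M : TM} {K L : ℕ} {a b c : M.Cfg} (h : M.Reaches K a b)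
    (h' : M.Reaches L b c) : M.Reaches (K + L) a c := by
  obtain ⟨k, hk, rfl⟩ := h
  obtain ⟨l, hl, rfl⟩ := h'
  exact ⟨l + k, by omega, Function.iterate_add_apply _ _ _ _⟩

theorem Reaches.mono {M : TM} {K L : ℕ} (hKL : K ≤ L) {a b : M.Cfg} (h : M.Reaches K a b) :
    M.Reaches L a b := by
  obtain ⟨k, hk, h⟩ := h
  exact ⟨k, hk.trans hKL, h⟩

theorem reaches_of_forall_step {M : TM} (F : ℕ → M.Cfg) (K : ℕ)
    (h : ∀ k < K, M.step (F k) = F (k + 1)) : M.Reaches K (F 0) (F K) := by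
  refine ⟨K, le_rfl, ?_⟩
  induction K with
  | zero => rfl
  | succ K ih =>
    rw [Function.iterate_succ_apply', ih fun k hk => h k (by omega), h K (by omega)]

theorem eval_of_reaches {M : TM} {K : ℕ} {y r : List Bool} {b : M.Cfg}
    (h : M.Reaches K (M.initial y r) b) (hb : M.transition b = none) :
    M.eval K y r = some b.out := by
  obtain ⟨k, hk, rfl⟩ := h
  exact eval_mono hk (eval_eq_some_iff.2 ⟨hb, rfl⟩)

end TM

/-! ## Running a machine with a clock and a prescribed output length -/

namespace PaddedRun

/-- The work tapes: copies of the input (`copy false`) and of the coins (`copy true`), a blank coin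
tape and a tape of marks, and the work tapes of two machines. -/
inductive Tape (V W : Type) : Type
  | copy (b : Bool) : Tape V W
  | noCoin : Tape V W
  | marks : Tape V W
  | left (v : V) : Tape V W
  | right (w : W) : Tape V W

/-- The states: copying a tape, rewinding it, running two machines, and padding the output. -/
inductive Phase (P Q : Type) : Type
  | copy (b : Bool) : Phase P Q
  | rewind (b : Bool) : Phase P Q
  | count (p : P) : Phase P Q
  | run (q : Q) : Phase P Q
  | pad : Phase P Q

instance {V W : Type} [Finite V] [Finite W] : Finite (Tape V W) := by
  refine Finite.of_surjective
    (fun s : Bool ⊕ Bool ⊕ V ⊕ W => match s with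
      | .inl b => Tape.copy b
      | .inr (.inl true) => Tape.noCoin
      | .inr (.inl false) => Tape.marks
      | .inr (.inr (.inl v)) => Tape.left v
      | .inr (.inr (.inr w)) => Tape.right w) ?_
  rintro (b | _ | _ | v | w)
  exacts [⟨.inl b, rfl⟩, ⟨.inr (.inl true), rfl⟩, ⟨.inr (.inl false), rfl⟩,
    ⟨.inr (.inr (.inl v)), rfl⟩, ⟨.inr (.inr (.inr w)), rfl⟩]

instance {P Q : Type} [Finite P] [Finite Q] : Finite (Phase P Q) := by
  refine Finite.of_surjective
    (fun s : Bool ⊕ Bool ⊕ P ⊕ Q ⊕ Unit => match s with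
      | .inl b => Phase.copy b
      | .inr (.inl b) => Phase.rewind b
      | .inr (.inr (.inl p)) => Phase.count p
      | .inr (.inr (.inr (.inl q))) => Phase.run q
      | .inr (.inr (.inr (.inr ()))) => Phase.pad) ?_
  rintro (b | b | p | q | _)
  exacts [⟨.inl b, rfl⟩, ⟨.inr (.inl b), rfl⟩, ⟨.inr (.inr (.inl p)), rfl⟩,
    ⟨.inr (.inr (.inr (.inl q))), rfl⟩, ⟨.inr (.inr (.inr (.inr ()))), rfl⟩]

variable {V W P Q : Type}

/-- The tape to be copied. -/
def source (b : Bool) : TapeIx (Tape V W) := if b then .coin else .input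

/-- The copy. -/
def target (b : Bool) : TapeIx (Tape V W) := .work (.copy b)

theorem target_ne_source (b b' : Bool) : (target b : TapeIx (Tape V W)) ≠ source b' := by
  cases b' <;> simp [target, source]

/-- The tapes of the first machine. -/
def leftTape : TapeIx V → TapeIx (Tape V W)
  | .input => .work (.copy false)
  | .coin => .work .noCoin
  | .work v => .work (.left v)

/-- The tapes of the second machine. -/
def rightTape : TapeIx W → TapeIx (Tape V W)
  | .input => .input
  | .coin => .coin
  | .work w => .work (.right w)

/-- The state after the rewinding of a tape. -/
def afterRewind (p : P) : Bool → Phase P Q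
  | false => .copy true
  | true => .count p

open Classical in
/-- The actions that write `f i` on the tape `i`, for the source and the target of a copy, and then
move the heads by `s`. -/
noncomputable def copyActs (b : Bool) (ρ f : TapeIx (Tape V W) → Option Bool) (s : SignType)
    (i : TapeIx (Tape V W)) : Option Bool × SignType :=
  if i = source b ∨ i = target b then (f i, s) else (ρ i, 0)

/-- The action on the tape of marks when the first machine writes `o`. -/
def countMark (c : Option Bool) : Option Bool → Option Bool × SignType
  | none => (c, 0)
  | some true => (some true, 1)
  -- The `0` that ends the unary number leaves no mark; the head goes back to the last mark, cell `m
  -- - 1`.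
  | some false => (c, -1)

/-- The actions in a step of the first machine. -/
def countActs (ρ : TapeIx (Tape V W) → Option Bool) (acts : TapeIx V → Option Bool × SignType)
    (o : Option Bool) : TapeIx (Tape V W) → Option Bool × SignType
  | .work (.copy false) => acts .input
  | .work .noCoin => acts .coin
  | .work (.left v) => acts (.work v)
  | .work .marks => countMark (ρ (.work .marks)) o
  | i => (ρ i, 0)

/-- The actions in a step of the second machine. -/
def runActs (ρ : TapeIx (Tape V W) → Option Bool) (acts : TapeIx W → Option Bool × SignType)
    (o : Option Bool) : TapeIx (Tape V W) → Option Bool × SignType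
  | .input => acts .input
  | .coin => acts .coin
  | .work (.right w) => acts (.work w)
  -- The clock: one cell of the copied coins per step of `U`.
  | .work (.copy true) => (ρ (.work (.copy true)), 1)
  | .work .marks =>
      (ρ (.work .marks), if o.isSome ∧ (ρ (.work .marks)).isSome then -1 else 0)
  | i => (ρ i, 0)

/-- The actions in a step of the padding. -/
def padActs (ρ : TapeIx (Tape V W) → Option Bool) :
    TapeIx (Tape V W) → Option Bool × SignType
  | .work .marks => (ρ (.work .marks), -1)
  | i => (ρ i, 0)

variable {D U : TM}

/-- The transition function. -/
noncomputable def next (D U : TM) (q : Phase D.State U.State)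
    (ρ : TapeIx (Tape D.Work U.Work) → Option Bool) :
    Option (Phase D.State U.State × (TapeIx (Tape D.Work U.Work) → Option Bool × SignType) ×
      Option Bool) :=
  match q with
  | .copy b =>
    match ρ (source b) with
    | some c => some (.copy b, copyActs b ρ (fun _ => some c) 1, none)
    | none => some (.rewind b, copyActs b ρ ρ (-1), none)
  | .rewind b =>
    match ρ (source b) with
    | some _ => some (.rewind b, copyActs b ρ ρ (-1), none)
    | none => some (afterRewind D.start b, copyActs b ρ ρ 1, none)
  | .count p =>
    match D.δ p fun i => ρ (leftTape i) with
    | none => none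
    | some (p', acts, o) =>
      some (if o = some false then .run U.start else .count p', countActs ρ acts o, none)
  | .run q =>
    match ρ (.work (.copy true)) with
    | none => some (.pad, fun i => (ρ i, 0), none)
    | some _ =>
      match U.δ q fun i => ρ (rightTape i) with
      | none => some (.pad, fun i => (ρ i, 0), none)
      | some (q', acts, o) =>
        -- Once the marks are used up, further output of `U` is suppressed.
        some (.run q', runActs ρ acts o, if (ρ (.work .marks)).isSome then o else none)
  | .pad =>
    match ρ (.work .marks) with
    | some _ => some (.pad, padActs ρ, some false)
    | none => none

end PaddedRun

open PaddedRun

/-- The machine that first runs `D` on the input, without coins, up to the first `0` in its output,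
and then runs `U` on the input and the coins, with as many steps as there are coins.  The output of
`U` is truncated or padded to the number of `1`s at the start of the output of `D`. -/
noncomputable def TM.paddedRun (D U : TM) : TM where
  State := Phase D.State U.State
  Work := Tape D.Work U.Work
  finState := by
    have := D.finState
    have := U.finState
    infer_instance
  finWork := by
    have := D.finWork
    have := U.finWork
    infer_instance
  start := .copy false
  δ := next D U

/-! ### The copying phase -/

namespace PaddedRun

variable {D U : TM}

/-- A configuration, given by its state, tapes and output. -/
def config (q : Phase D.State U.State) (σ : TapeIx (Tape D.Work U.Work) → TMTape)
    (o : List Bool) : (TM.paddedRun D U).Cfg :=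
  ⟨q, σ, o⟩

theorem step_config {q q' : Phase D.State U.State} {σ : TapeIx (Tape D.Work U.Work) → TMTape}
    {acts : TapeIx (Tape D.Work U.Work) → Option Bool × SignType} {o : List Bool}
    {b : Option Bool} (h : next D U q (fun i => (σ i).read) = some (q', acts, b)) :
    (TM.paddedRun D U).step (config q σ o) =
      config q' (fun i => (σ i).act (acts i)) (o ++ b.toList) :=
  TM.step_of_transition_eq_some (M := TM.paddedRun D U) (a := config q σ o) h

open Classical in
/-- The tapes `σ`, with `τ` and `τ'` in the place of the source and the target of a copy. -/
noncomputable def copyTapes (b : Bool) (σ : TapeIx (Tape D.Work U.Work) → TMTape)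
    (τ τ' : TMTape) (i : TapeIx (Tape D.Work U.Work)) : TMTape :=
  if i = source b then τ else if i = target b then τ' else σ i

theorem copyTapes_source (b : Bool) (σ : TapeIx (Tape D.Work U.Work) → TMTape) (τ τ' : TMTape) :
    copyTapes b σ τ τ' (source b) = τ := by
  simp [copyTapes]

theorem copyTapes_act (b : Bool) (σ : TapeIx (Tape D.Work U.Work) → TMTape) (τ τ' : TMTape)
    (f : TapeIx (Tape D.Work U.Work) → Option Bool) (s : SignType) :
    (fun i => (copyTapes b σ τ τ' i).act
      (copyActs b (fun i => (copyTapes b σ τ τ' i).read) f s i)) =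
    copyTapes b σ (τ.act (f (source b), s)) (τ'.act (f (target b), s)) := by
  funext i
  by_cases h : i = source b
  · subst h; simp [copyTapes, copyActs]
  by_cases h' : i = target b
  · subst h'; simp [copyTapes, copyActs, target_ne_source]
  · simp [copyTapes, copyActs, h, h', TMTape.act_read_zero]

theorem copyTapes_target (b : Bool) (σ : TapeIx (Tape D.Work U.Work) → TMTape) (τ τ' : TMTape) :
    copyTapes b σ τ τ' (target b) = τ' := by
  simp [copyTapes, target_ne_source]

theorem copyTapes_self (b : Bool) (σ : TapeIx (Tape D.Work U.Work) → TMTape) :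
    copyTapes b σ (σ (source b)) (σ (target b)) = σ := by
  funext i
  simp only [copyTapes]
  split_ifs with h h' <;> simp [*]

theorem reaches_copy (b : Bool) (σ : TapeIx (Tape D.Work U.Work) → TMTape) (l o : List Bool)
    (h : σ (source b) = TMTape.ofList l) (h' : σ (target b) = TMTape.ofList []) :
    (TM.paddedRun D U).Reaches (l.length + 1) (config (.copy b) σ o)
      (config (.rewind b) (copyTapes b σ (TMTape.ofListAt l ((l.length : ℤ) - 1))
        (TMTape.ofListAt l ((l.length : ℤ) - 1))) o) := by
  -- Invariant: after `k` steps the first `k` symbols are copied and both heads are on cell `k`.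
  let F : ℕ → TapeIx (Tape D.Work U.Work) → TMTape := fun k =>
    copyTapes b σ (TMTape.ofListAt l k) (TMTape.ofListAt (l.take k) k)
  have h0 : F 0 = σ := by
    simp only [F, List.take_zero, Nat.cast_zero, TMTape.ofListAt_zero, ← h, ← h', copyTapes_self]
  have hloop := TM.reaches_of_forall_step (M := TM.paddedRun D U)
    (fun k => config (.copy b) (F k) o) l.length fun k hk => by
      have ht : next D U (.copy b) (fun i => (F k i).read) = some (.copy b,
          copyActs b (fun i => (F k i).read) (fun _ => some l[k]) 1, none) := by
        simp [next, F, copyTapes_source, TMTape.read_ofListAt_natCast, hk]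
      rw [step_config ht]
      have h1 := TMTape.act_ofListAt_length (l.take k) l[k]
      have h2 := TMTape.act_read_ofListAt l k 1
      rw [TMTape.read_ofListAt_natCast, List.getElem?_eq_getElem hk] at h2
      rw [List.length_take_of_le hk.le, List.take_append_getElem] at h1
      simp only [F, copyTapes_act, Option.toList_none, List.append_nil, h1, h2]
      simp
  simp only [h0] at hloop
  refine hloop.trans (.single ?_)
  have ht : next D U (.copy b) (fun i => (F l.length i).read) = some (.rewind b,
      copyActs b (fun i => (F l.length i).read) (fun i => (F l.length i).read) (-1), none) := by
    simp [next, F, copyTapes_source, TMTape.read_ofListAt_natCast]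
  rw [step_config ht]
  simp only [F, copyTapes_act, copyTapes_source, copyTapes_target, Option.toList_none,
    List.append_nil, TMTape.act_read_ofListAt, List.take_length]
  rfl

theorem reaches_rewind (b : Bool) (σ : TapeIx (Tape D.Work U.Work) → TMTape) (l o : List Bool) :
    (TM.paddedRun D U).Reaches (l.length + 1)
      (config (.rewind b) (copyTapes b σ (TMTape.ofListAt l ((l.length : ℤ) - 1))
        (TMTape.ofListAt l ((l.length : ℤ) - 1))) o)
      (config (afterRewind D.start b)
        (copyTapes b σ (TMTape.ofList l) (TMTape.ofList l)) o) := by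
  let F : ℕ → TapeIx (Tape D.Work U.Work) → TMTape := fun k =>
    copyTapes b σ (TMTape.ofListAt l ((l.length : ℤ) - 1 - k))
      (TMTape.ofListAt l ((l.length : ℤ) - 1 - k))
  have h0 : F 0 = copyTapes b σ (TMTape.ofListAt l ((l.length : ℤ) - 1))
        (TMTape.ofListAt l ((l.length : ℤ) - 1)) := by
    simp [F]
  have hloop := TM.reaches_of_forall_step (M := TM.paddedRun D U)
    (fun k => config (.rewind b) (F k) o) l.length fun k hk => by
      have ht : next D U (.rewind b) (fun i => (F k i).read) = some (.rewind b,
          copyActs b (fun i => (F k i).read) (fun i => (F k i).read) (-1), none) := by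
        have : (l.length : ℤ) - 1 - k = ((l.length - 1 - k : ℕ) : ℤ) := by omega
        have hr : l.length - 1 - k < l.length := by omega
        simp only [next, F, copyTapes_source, this, TMTape.read_ofListAt_natCast,
          List.getElem?_eq_getElem hr]
      rw [step_config ht]
      have : (l.length : ℤ) - 1 - k + ((-1 : SignType) : ℤ) =
          (l.length : ℤ) - 1 - (k + 1 : ℕ) := by
        simp; ring
      simp only [F, copyTapes_act, copyTapes_source, copyTapes_target, Option.toList_none,
        List.append_nil, TMTape.act_read_ofListAt, this]
  simp only [h0] at hloop
  refine hloop.trans (.single ?_)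
  -- The blank on cell `-1` ends the rewinding; the last move to the right returns both heads to
  -- cell `0`.
  have hz : (l.length : ℤ) - 1 - l.length = -1 := by ring
  have ht : next D U (.rewind b) (fun i => (F l.length i).read) = some (afterRewind D.start b,
      copyActs b (fun i => (F l.length i).read) (fun i => (F l.length i).read) 1, none) := by
    simp only [next, F, copyTapes_source, hz, TMTape.read_ofListAt_neg_one]
  rw [step_config ht]
  simp only [F, copyTapes_act, copyTapes_source, copyTapes_target, Option.toList_none,
    List.append_nil, TMTape.act_read_ofListAt, hz]
  rfl

theorem reaches_afterRewind (b : Bool) (σ : TapeIx (Tape D.Work U.Work) → TMTape)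
    (l o : List Bool) (h : σ (source b) = TMTape.ofList l)
    (h' : σ (target b) = TMTape.ofList []) :
    (TM.paddedRun D U).Reaches (2 * l.length + 2) (config (.copy b) σ o)
      (config (afterRewind D.start b)
        (copyTapes b σ (TMTape.ofList l) (TMTape.ofList l)) o) :=
  ((reaches_copy b σ l o h h').trans (reaches_rewind b σ l o)).mono (by omega)

/-- The tapes after the input and the coins have been copied. -/
def copiedTapes (D U : TM) (y r : List Bool) : TapeIx (Tape D.Work U.Work) → TMTape
  | .input => TMTape.ofList y
  | .coin => TMTape.ofList r
  | .work (.copy false) => TMTape.ofList y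
  | .work (.copy true) => TMTape.ofList r
  | .work _ => TMTape.ofList []

theorem reaches_copiedTapes (y r : List Bool) :
    (TM.paddedRun D U).Reaches (2 * y.length + 2 * r.length + 4)
      ((TM.paddedRun D U).initial y r) (config (.count D.start) (copiedTapes D U y r) []) := by
  have h₁ := reaches_afterRewind (D := D) (U := U) false
    ((TM.paddedRun D U).initial y r).tape y [] rfl rfl
  have h₂ := reaches_afterRewind (D := D) (U := U) true
    (copyTapes false ((TM.paddedRun D U).initial y r).tape (TMTape.ofList y) (TMTape.ofList y))
    r [] (by simp [copyTapes, source, target]; rfl) (by simp [copyTapes, source, target]; rfl)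
  have h₃ : copyTapes true (copyTapes false ((TM.paddedRun D U).initial y r).tape
      (TMTape.ofList y) (TMTape.ofList y)) (TMTape.ofList r) (TMTape.ofList r) =
      copiedTapes D U y r := by
    funext i
    rcases i with _ | _ | (_ | _) | _ | _ | _ | _ <;>
      simp [copiedTapes, copyTapes, source, target] <;> rfl
  rw [h₃] at h₂
  exact (h₁.trans h₂).mono (by omega)

end PaddedRun

/-! ### The counting, simulation and padding phases -/

namespace PaddedRun

variable {D U : TM}

/-- The tapes `σ` hold the configuration `a` of the first machine, with its output on the tape of
marks, and agree with `σ₀` on the tapes of the second machine and on the clock. -/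
structure Counting (a : D.Cfg) (σ₀ σ : TapeIx (Tape D.Work U.Work) → TMTape) : Prop where
  left : ∀ i, σ (leftTape i) = a.tape i
  marks : σ (.work .marks) = TMTape.ofListAt a.out a.out.length
  right : ∀ i, σ (rightTape i) = σ₀ (rightTape i)
  clock : σ (.work (.copy true)) = σ₀ (.work (.copy true))

theorem countActs_leftTape {V W : Type} (ρ : TapeIx (Tape V W) → Option Bool)
    (acts : TapeIx V → Option Bool × SignType) (o : Option Bool) (i : TapeIx V) :
    countActs ρ acts o (leftTape i) = acts i := by
  cases i <;> rfl

theorem countActs_rightTape {V W : Type} (ρ : TapeIx (Tape V W) → Option Bool)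
    (acts : TapeIx V → Option Bool × SignType) (o : Option Bool) (i : TapeIx W) :
    countActs ρ acts o (rightTape i) = (ρ (rightTape i), 0) := by
  cases i <;> rfl

theorem runActs_rightTape {V W : Type} (ρ : TapeIx (Tape V W) → Option Bool)
    (acts : TapeIx W → Option Bool × SignType) (o : Option Bool) (i : TapeIx W) :
    runActs ρ acts o (rightTape i) = acts i := by
  cases i <;> rfl

theorem Counting.step {a : D.Cfg} {σ₀ σ : TapeIx (Tape D.Work U.Work) → TMTape}
    (h : Counting a σ₀ σ) {q : D.State} {acts : TapeIx D.Work → Option Bool × SignType}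
    {o : Option Bool} (ht : D.transition a = some (q, acts, o)) (l : List Bool) :
    (TM.paddedRun D U).step (config (.count a.state) σ l) =
      config (if o = some false then .run U.start else .count q)
        (fun i => (σ i).act (countActs (fun i => (σ i).read) acts o i)) l := by
  have h' : next D U (.count a.state) (fun i => (σ i).read) =
      some (if o = some false then .run U.start else .count q,
        countActs (fun i => (σ i).read) acts o, none) := by
    have : D.δ a.state (fun i => (σ (leftTape i)).read) = some (q, acts, o) := by
      simp only [h.left]; exact ht
    simp only [next, this]
  rw [step_config h', Option.toList_none, List.append_nil]

/-- Until `D` writes a `0`, it is simulated step by step. If `D` has halted, its iterates no longer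
change, and the bound on the number of steps merely becomes slack. -/
theorem reaches_count {a : D.Cfg} {σ₀ σ : TapeIx (Tape D.Work U.Work) → TMTape}
    (h : Counting a σ₀ σ) (l : List Bool) (k : ℕ) (hk : false ∉ (D.step^[k] a).out) :
    ∃ σ', (TM.paddedRun D U).Reaches k (config (.count a.state) σ l)
      (config (.count (D.step^[k] a).state) σ' l) ∧ Counting (D.step^[k] a) σ₀ σ' := by
  induction k with
  | zero => exact ⟨σ, .refl _, h⟩
  | succ k ih =>
    rw [Function.iterate_succ_apply'] at hk ⊢
    obtain ⟨σ', h₁, h₂⟩ := ih fun hf => hk ((D.out_prefix_step _).subset hf)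
    generalize D.step^[k] a = b at *
    rcases ht : D.transition b with _ | ⟨q, acts, o⟩
    · rw [TM.step_of_transition_eq_none ht]
      exact ⟨σ', h₁.mono (by omega), h₂⟩
    · have hs := TM.step_of_transition_eq_some ht
      rw [hs] at hk ⊢
      have ho : o ≠ some false := by
        rintro rfl; simp at hk
      have hs' := h₂.step ht l
      rw [if_neg ho] at hs'
      refine ⟨_, h₁.trans (.single hs'), ⟨fun i => ?_, ?_, fun i => ?_, ?_⟩⟩
      · simp only [countActs_leftTape, h₂.left]
      · rcases o with _ | _ | _
        · simp [countActs, countMark, TMTape.act_read_zero, h₂.marks]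
        · exact absurd rfl ho
        · simp [countActs, countMark, h₂.marks, TMTape.act_ofListAt_length]
      · simp only [countActs_rightTape, TMTape.act_read_zero, h₂.right]
      · simp only [countActs, TMTape.act_read_zero, h₂.clock]

/-- Consider the first step after which the output of `D` contains a `0`. Before it there are only
`1`s, one mark each; after it the output is a prefix of `1^m 0 z`, which forces the number of marks
to be `m`. -/
theorem reaches_run {s m : ℕ} {y r z : List Bool}
    (hD : D.eval s y [] = some (QCircuit.codeNat m ++ z)) :
    ∃ σ, (TM.paddedRun D U).Reaches s (config (.count D.start) (copiedTapes D U y r) [])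
        (config (.run U.start) σ []) ∧
      (∀ i, σ (rightTape i) = (U.initial y r).tape i) ∧
      σ (.work (.copy true)) = TMTape.ofListAt r (0 : ℕ) ∧
      σ (.work .marks) = TMTape.ofListAt (List.replicate m true) ((m : ℤ) - 1) := by
  classical
  rw [TM.eval_eq_some_iff] at hD
  have hex : ∃ k, false ∈ (D.step^[k] (D.initial y [])).out :=
    ⟨s, by simp [hD.2, QCircuit.codeNat]⟩
  obtain ⟨k, hk⟩ : ∃ k, Nat.find hex = k + 1 := by
    refine Nat.exists_eq_succ_of_ne_zero fun h0 => ?_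
    have := Nat.find_spec hex
    rw [h0] at this
    simp [TM.initial] at this
  have hks : k + 1 ≤ s := hk ▸ Nat.find_min' hex (by simp [hD.2, QCircuit.codeNat])
  have hmem := Nat.find_spec hex
  have hnot : false ∉ (D.step^[k] (D.initial y [])).out := Nat.find_min hex (by omega)
  rw [hk, Function.iterate_succ_apply'] at hmem
  have hinit : Counting (U := U) (D.initial y []) (copiedTapes D U y r) (copiedTapes D U y r) := by
    refine ⟨fun i => ?_, rfl, fun _ => rfl, rfl⟩
    cases i <;> rfl
  obtain ⟨σ, h₁, h₂⟩ := reaches_count hinit [] k hnot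
  have hpre : (D.step (D.step^[k] (D.initial y []))).out <+: QCircuit.codeNat m ++ z := by
    obtain ⟨d, rfl⟩ := Nat.exists_eq_add_of_le' hks
    rw [← hD.2, Function.iterate_add_apply, Function.iterate_succ_apply']
    exact D.out_prefix_iterate _ _
  generalize D.step^[k] (D.initial y []) = a at *
  rcases ht : D.transition a with _ | ⟨q, acts, o⟩
  · rw [TM.step_of_transition_eq_none ht] at hmem
    exact absurd hmem hnot
  have hs := h₂.step ht []
  rw [TM.step_of_transition_eq_some ht] at hmem hpre
  have ho : o = some false := by
    rcases o with _ | _ | _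
    · simp [hnot] at hmem
    · rfl
    · simp [hnot] at hmem
  subst ho
  have hout : a.out = List.replicate a.out.length true := by
    refine List.eq_replicate_of_mem fun b hb => ?_
    cases b
    · exact absurd hb hnot
    · rfl
  obtain ⟨z', hz'⟩ := hpre
  -- Both sides begin with a self-delimiting number, so the two numbers agree.
  have hlen : a.out.length = m := by
    refine (QCircuit.codeNat_append_inj (l := z') (l' := z) ?_).1
    rw [← hz', QCircuit.codeNat, ← hout]
    simp
  rw [if_pos rfl] at hs
  refine ⟨_, (h₁.trans (.single hs)).mono hks, fun i => ?_, ?_, ?_⟩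
  · simp only [countActs_rightTape, TMTape.act_read_zero, h₂.right]
    cases i <;> rfl
  · simp only [countActs, TMTape.act_read_zero, h₂.clock]
    rfl
  · simp only [countActs, countMark, TMTape.act_read, h₂.marks]
    rw [← hlen, ← hout]
    simp [TMTape.ofListAt, sub_eq_add_neg]

/-- Induction on the number `p` of ticks left. The invariant is that the output is that of `U`
truncated to `m` bits, with `m - |out|` marks left (truncated subtraction). Padding starts when `U`
halts or the clock runs out; this switch costs the extra step. -/
theorem reaches_pad_of_run {m : ℕ} {r : List Bool} (p : ℕ) (a : U.Cfg)
    (σ : TapeIx (Tape D.Work U.Work) → TMTape) (h : ℕ) (hσ : ∀ i, σ (rightTape i) = a.tape i)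
    (hc : σ (.work (.copy true)) = TMTape.ofListAt r h) (hp : r.length = h + p)
    (hm : σ (.work .marks) =
      TMTape.ofListAt (List.replicate m true) (((m - a.out.length : ℕ) : ℤ) - 1)) :
    ∃ σ', (TM.paddedRun D U).Reaches (p + 1) (config (.run a.state) σ (a.out.take m))
        (config .pad σ' ((U.step^[p] a).out.take m)) ∧
      σ' (.work .marks) = TMTape.ofListAt (List.replicate m true)
        (((m - (U.step^[p] a).out.length : ℕ) : ℤ) - 1) := by
  induction p generalizing a σ h with
  | zero =>
    have ht : next D U (.run a.state) (fun i => (σ i).read) =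
        some (.pad, fun i => ((σ i).read, 0), none) := by
      simp [next, hc, TMTape.read_ofListAt_natCast, hp]
    have hs := step_config (o := a.out.take m) ht
    simp only [TMTape.act_read_zero, Option.toList_none, List.append_nil] at hs
    exact ⟨σ, .single hs, hm⟩
  | succ p ih =>
    have hcr : (σ (.work (.copy true))).read = some (r[h]'(by omega)) := by
      rw [hc, TMTape.read_ofListAt_natCast, List.getElem?_eq_getElem]
    rcases ha : U.transition a with _ | ⟨q, acts, o⟩
    · have ht : next D U (.run a.state) (fun i => (σ i).read) =
          some (.pad, fun i => ((σ i).read, 0), none) := by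
        have : U.δ a.state (fun i => (σ (rightTape i)).read) = none := by
          simp only [hσ]; exact ha
        simp only [next, hcr, this]
      have hs := step_config (o := a.out.take m) ht
      simp only [TMTape.act_read_zero, Option.toList_none, List.append_nil] at hs
      rw [TM.iterate_step_of_halted ha]
      exact ⟨σ, (TM.Reaches.single hs).mono (by omega), hm⟩
    · have ht : next D U (.run a.state) (fun i => (σ i).read) =
          some (.run q, runActs (fun i => (σ i).read) acts o,
            if (σ (.work .marks)).read.isSome then o else none) := by
        have : U.δ a.state (fun i => (σ (rightTape i)).read) = some (q, acts, o) := by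
          simp only [hσ]; exact ha
        simp only [next, hcr, this]
      have hs := step_config (o := a.out.take m) ht
      have hstep := TM.step_of_transition_eq_some ha
      have hc' : ((σ (.work (.copy true))).act
          (runActs (fun i => (σ i).read) acts o (.work (.copy true)))) =
          TMTape.ofListAt r (h + 1 : ℕ) := by
        simp only [runActs, hc, TMTape.act_read_ofListAt]
        simp
      have hσ' : ∀ i, (σ (rightTape i)).act
          (runActs (fun i => (σ i).read) acts o (rightTape i)) = (U.step a).tape i := by
        intro i
        rw [hstep, runActs_rightTape, hσ]
      have hout : a.out.take m ++
            (if (σ (.work .marks)).read.isSome then o else none).toList =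
            (U.step a).out.take m ∧
          (σ (.work .marks)).act (runActs (fun i => (σ i).read) acts o (.work .marks)) =
            TMTape.ofListAt (List.replicate m true)
              (((m - (U.step a).out.length : ℕ) : ℤ) - 1) := by
        rw [hstep]
        simp only [runActs, hm, TMTape.act_read_ofListAt]
        rcases o with _ | b
        · simp
        -- A bit is written: either there is room and a mark is consumed, or the output is full and
        -- neither output nor marks change.
        · rcases lt_or_ge a.out.length m with hlt | hge
          · obtain ⟨j, hj⟩ : ∃ j, m - a.out.length = j + 1 := ⟨m - a.out.length - 1, by omega⟩
            have hj' : m - (a.out.length + 1) = j := by omega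
            rw [hj, TMTape.read_marks m j (by omega)]
            simp only [Option.isSome_some, if_true, and_self, Option.toList_some,
              List.length_append, List.length_singleton, hj']
            rw [List.take_of_length_le hlt.le, List.take_of_length_le (by simp; omega)]
            refine ⟨rfl, ?_⟩
            congr 1
            simp [sub_eq_add_neg]
          · have h0 : m - a.out.length = 0 := by omega
            have h0' : m - (a.out.length + 1) = 0 := by omega
            rw [h0, TMTape.read_marks_zero m]
            simp [h0', List.take_append_of_le_length hge]
      rw [hout.1] at hs
      obtain ⟨σ', h₁, h₂⟩ := ih (U.step a)
        (fun i => (σ i).act (runActs (fun i => (σ i).read) acts o i)) (h + 1) hσ' hc' (by omega) hout.2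
      refine ⟨σ', ?_, h₂⟩
      rw [show q = (U.step a).state by rw [hstep]] at hs
      exact ((TM.Reaches.single hs).trans h₁).mono (by omega)

theorem reaches_halted_of_pad {m : ℕ} (j : ℕ) (hj : j ≤ m)
    (σ : TapeIx (Tape D.Work U.Work) → TMTape) (o : List Bool)
    (hm : σ (.work .marks) = TMTape.ofListAt (List.replicate m true) ((j : ℤ) - 1)) :
    ∃ b, (TM.paddedRun D U).Reaches j (config .pad σ o) b ∧
      (TM.paddedRun D U).transition b = none ∧ b.out = o ++ List.replicate j false := by
  induction j generalizing σ o with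
  | zero =>
    refine ⟨_, .refl _, ?_, by simp [config]⟩
    change next D U .pad (fun i => (σ i).read) = none
    simp only [next, hm, TMTape.read_marks_zero]
  | succ j ih =>
    have ht : next D U .pad (fun i => (σ i).read) =
        some (.pad, padActs (fun i => (σ i).read), some false) := by
      simp only [next, hm, TMTape.read_marks m j hj]
    have hm' : (σ (.work .marks)).act (padActs (fun i => (σ i).read) (.work .marks)) =
        TMTape.ofListAt (List.replicate m true) ((j : ℤ) - 1) := by
      simp only [padActs, hm, TMTape.act_read_ofListAt]
      simp [sub_eq_add_neg]
    obtain ⟨b, h₁, h₂, h₃⟩ := ih (by omega)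
      (fun i => (σ i).act (padActs (fun i => (σ i).read) i)) (o ++ [false]) hm'
    refine ⟨b, ((TM.Reaches.single (step_config ht)).trans h₁).mono (by omega), h₂, ?_⟩
    rw [h₃, List.replicate_succ]
    simp

end PaddedRun

/-- `paddedRun D U` always halts with an output of the prescribed length `m`, which is the output of
`U` if that halts in time and has this length. -/
theorem TM.eval_paddedRun {D : TM} (U : TM) {s m : ℕ} {y z : List Bool} (r : List Bool)
    (hD : D.eval s y [] = some (QCircuit.codeNat m ++ z)) :
    ∃ x : List Bool, x.length = m ∧
      (TM.paddedRun D U).eval (2 * y.length + 3 * r.length + s + m + 5) y r = some x ∧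
      ∀ x' : List Bool, x'.length = m → U.eval r.length y r = some x' → x' = x := by
  obtain ⟨σ, h₁, hσ, hc, hm⟩ := reaches_run (U := U) (r := r) hD
  obtain ⟨σ', h₂, hm'⟩ := reaches_pad_of_run r.length (U.initial y r) σ 0 hσ hc (by omega)
    (by simpa [TM.initial] using hm)
  obtain ⟨b, h₃, hb, hout⟩ := reaches_halted_of_pad _ (Nat.sub_le _ _) σ' _ hm'
  rw [show (U.initial y r).out.take m = [] from List.take_nil] at h₂
  -- Step count: `2|y| + 2|r| + 4` for the copies, `s` for `D`, `|r| + 1` for `U`, at most `m` for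
  -- the padding.
  have h := ((reaches_copiedTapes y r).trans h₁).trans (h₂.trans h₃)
  refine ⟨b.out, ?_, TM.eval_of_reaches (h.mono (by omega)) hb, ?_⟩
  · rw [hout]; simp; omega
  · intro x' hx' hU
    rw [TM.eval_eq_some_iff] at hU
    rw [hout, hU.2, hx', List.take_of_length_le hx'.le]
    simp

/-! ## Output distributions of quantum circuits -/

/-- Gates are unitary: `T` multiplies amplitudes by phases and `CNOT` permutes the basis. For `H`,
the parallelogram law applies to each pair of basis vectors that differ in bit `i`. -/
theorem QGate.sum_norm_sq_apply {N : ℕ} (g : QGate N) (ψ : (Fin N → Bool) → ℂ) :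
    ∑ b, ‖g.apply ψ b‖ ^ 2 = ∑ b, ‖ψ b‖ ^ 2 := by
  cases g with
  | H i =>
    let flip : (Fin N → Bool) → (Fin N → Bool) := fun b => Function.update b i (!b i)
    have hflip : Function.Involutive flip := fun b => by simp [flip]
    have hsum : ∀ F : (Fin N → Bool) → ℝ, ∑ b, F (flip b) = ∑ b, F b := fun F =>
      Equiv.sum_comp hflip.toPerm F
    have hsq : ‖((Real.sqrt 2 : ℝ) : ℂ)‖ ^ 2 = 2 := by
      rw [Complex.norm_real, Real.norm_eq_abs, sq_abs, Real.sq_sqrt (by norm_num)]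
    have hpair : ∀ b, ‖(QGate.H i).apply ψ b‖ ^ 2 + ‖(QGate.H i).apply ψ (flip b)‖ ^ 2 =
        ‖ψ b‖ ^ 2 + ‖ψ (flip b)‖ ^ 2 := by
      intro b
      have hlaw := fun u v : ℂ => parallelogram_law_with_norm ℂ u v
      cases hb : b i
      · have h₀ : Function.update b i false = b := by rw [← hb, Function.update_eq_self]
        have h₁ := hlaw (ψ b) (ψ (Function.update b i true))
        simp only [QGate.apply, flip, hb, Function.update_idem, h₀, Function.update_self,
          norm_div, div_pow, hsq, Bool.not_false, if_true, Bool.false_eq_true, if_false, one_mul,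
          neg_one_mul, ← sub_eq_add_neg]
        linarith
      · have h₀ : Function.update b i true = b := by rw [← hb, Function.update_eq_self]
        have h₁ := hlaw (ψ (Function.update b i false)) (ψ b)
        simp only [QGate.apply, flip, hb, Function.update_idem, h₀, Function.update_self,
          norm_div, div_pow, hsq, Bool.not_true, if_true, Bool.false_eq_true, if_false, one_mul,
          neg_one_mul, ← sub_eq_add_neg]
        linarith
    have h := Finset.sum_congr (rfl : (Finset.univ : Finset (Fin N → Bool)) = Finset.univ)
      fun b _ => hpair b
    rw [Finset.sum_add_distrib, Finset.sum_add_distrib,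
      hsum fun b => ‖(QGate.H i).apply ψ b‖ ^ 2, hsum fun b => ‖ψ b‖ ^ 2] at h
    linarith
  | T i =>
    refine Finset.sum_congr rfl fun b _ => ?_
    have : ‖Complex.exp (Real.pi / 4 * Complex.I)‖ = 1 := by
      have := Complex.norm_exp_ofReal_mul_I (Real.pi / 4)
      push_cast at this
      exact this
    simp only [QGate.apply]
    split_ifs <;> simp [this]
  | CNOT i j h =>
    have hinv : Function.Involutive
        fun b : Fin N → Bool => Function.update b j (xor (b j) (b i)) := fun b => by
      simp [Function.update_of_ne h]
    exact Equiv.sum_comp hinv.toPerm fun b => ‖ψ b‖ ^ 2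

namespace QCircuit

theorem sum_norm_sq_finalState (C : QCircuit) : ∑ b, ‖C.finalState b‖ ^ 2 = 1 := by
  have hfold : ∀ (gs : List (QGate C.qubits)) (ψ : (Fin C.qubits → Bool) → ℂ),
      ∑ b, ‖gs.foldl (fun ψ g => g.apply ψ) ψ b‖ ^ 2 = ∑ b, ‖ψ b‖ ^ 2 := by
    intro gs
    induction gs with
    | nil => exact fun _ => rfl
    | cons g gs ih => exact fun ψ => (ih _).trans (g.sum_norm_sq_apply ψ)
  rw [finalState, hfold, Finset.sum_eq_single fun _ => false]
  · simp
  · intro b _ hb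
    rw [if_neg fun h => hb (funext h)]
    simp
  · simp

theorem prob_nonneg (C : QCircuit) (x : List Bool) : 0 ≤ C.prob x :=
  Finset.sum_nonneg fun b _ => by split_ifs <;> positivity

theorem sum_prob (C : QCircuit) : ∑ x : Fin C.outBits → Bool, C.prob (List.ofFn x) = 1 := by
  classical
  simp only [prob]
  rw [Finset.sum_comm, ← C.sum_norm_sq_finalState]
  simp [List.ofFn_injective.eq_iff]

theorem decode_encode (C : QCircuit) : decode C.encode = some C :=
  Function.partialInv_left encode_injective C

theorem runCode_encode {C : QCircuit} {t : ℕ} (h : C.depth ≤ t) (x : List Bool) :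
    runCode t C.encode x = C.prob x := by
  simp [runCode, decode_encode, h]

theorem runCode_nonneg (t : ℕ) (c x : List Bool) : 0 ≤ runCode t c x := by
  unfold runCode
  split
  · split_ifs
    · exact prob_nonneg _ _
    · exact le_rfl
  · exact le_rfl

end QCircuit

/-! ## Distributions of samplers -/

theorem quantumProb_nonneg (D : TM) (T : Polynomial ℕ) (n : ℕ) (x : List Bool) :
    0 ≤ quantumProb D T n x := by
  unfold quantumProb
  split
  · exact QCircuit.runCode_nonneg _ _ _
  · exact le_rfl

theorem quantumProb_eq_prob {D : TM} {T : Polynomial ℕ} {n : ℕ} {C : QCircuit}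
    (hd : C.depth ≤ T.eval n) (h : D.eval (T.eval n) (ones n) [] = some C.encode)
    (x : List Bool) : quantumProb D T n x = C.prob x := by
  simp only [quantumProb, h, QCircuit.runCode_encode hd]

theorem IsQuantumSampler.sum_quantumProb {D : TM} {m T : Polynomial ℕ}
    (h : IsQuantumSampler D m T) (n : ℕ) :
    ∑ x : Fin (m.eval n) → Bool, quantumProb D T n (List.ofFn x) = 1 := by
  obtain ⟨C, hm, hd, hC⟩ := h n
  simp only [quantumProb_eq_prob hd (hC [])]
  rw [← hm]
  exact C.sum_prob

theorem classicalProb_nonneg (M : TM) (ℓ s : ℕ) (y x : List Bool) :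
    0 ≤ classicalProb M ℓ s y x :=
  div_nonneg (Finset.sum_nonneg fun r _ => by split_ifs <;> norm_num) (by positivity)

theorem classicalProb_le_classicalProb {M M' : TM} {ℓ s s' : ℕ} {y x : List Bool}
    (h : ∀ r : Fin ℓ → Bool, M.eval s y (List.ofFn r) = some x →
      M'.eval s' y (List.ofFn r) = some x) :
    classicalProb M ℓ s y x ≤ classicalProb M' ℓ s' y x := by
  refine div_le_div_of_nonneg_right (Finset.sum_le_sum fun r _ => ?_) (by positivity)
  by_cases h₁ : M.eval s y (List.ofFn r) = some x
  · rw [if_pos h₁, if_pos (h r h₁)]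
  · rw [if_neg h₁]
    split_ifs <;> norm_num

theorem sum_classicalProb_le_one (M : TM) (ℓ s k : ℕ) (y : List Bool) :
    ∑ x : Fin k → Bool, classicalProb M ℓ s y (List.ofFn x) ≤ 1 := by
  classical
  simp only [classicalProb]
  rw [← Finset.sum_div, Finset.sum_comm, div_le_one (by positivity)]
  refine (Finset.sum_le_card_nsmul _ _ 1 fun r _ => ?_).trans (by simp)
  by_cases h : ∃ x₀ : Fin k → Bool, M.eval s y (List.ofFn r) = some (List.ofFn x₀)
  · obtain ⟨x₀, h⟩ := h
    simp [h, List.ofFn_injective.eq_iff]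
  · push Not at h
    simp [h]

/-- If `Q` is at least `δ P` on `B`, then `1 - Δ(P, Q)` is at least `δ P(B)`. -/
theorem mul_sum_le_one_sub_statDist {k : ℕ} {P Q : List Bool → ℝ} {δ : ℝ}
    (hP₀ : ∀ x, 0 ≤ P x) (hQ₀ : ∀ x, 0 ≤ Q x)
    (hP : ∑ x : Fin k → Bool, P (List.ofFn x) = 1)
    (hQ : ∑ x : Fin k → Bool, Q (List.ofFn x) ≤ 1)
    (hδ : δ ≤ 1) (B : Finset (Fin k → Bool))
    (hB : ∀ x ∈ B, δ * P (List.ofFn x) ≤ Q (List.ofFn x)) :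
    δ * ∑ x ∈ B, P (List.ofFn x) ≤ 1 - statDist k P Q := by
  classical
  -- The right-hand side is `min (P x) (Q x)`. Its sum is at most `1 - Δ`, even when `Q` has total
  -- mass below `1`.
  have hmin : ∀ x : Fin k → Bool, (if x ∈ B then δ * P (List.ofFn x) else 0) ≤
      1 / 2 * (P (List.ofFn x) + Q (List.ofFn x) - |P (List.ofFn x) - Q (List.ofFn x)|) := by
    intro x
    have h₁ := hP₀ (List.ofFn x)
    have h₂ := hQ₀ (List.ofFn x)
    split_ifs with hx
    · have h₃ := hB x hx
      have h₄ := mul_le_of_le_one_left h₁ hδ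
      rcases abs_cases (P (List.ofFn x) - Q (List.ofFn x)) with h | h <;> linarith
    · rcases abs_cases (P (List.ofFn x) - Q (List.ofFn x)) with h | h <;> linarith
  have h := Finset.sum_le_sum fun x (_ : x ∈ Finset.univ) => hmin x
  rw [← Finset.mul_sum, Finset.sum_sub_distrib, Finset.sum_add_distrib, Finset.sum_ite_mem,
    Finset.univ_inter, ← Finset.mul_sum, hP] at h
  unfold statDist
  linarith

/-- A program that computes the code `c` whatever follows it contributes to the universal
distribution. -/
theorem runCode_div_le_universalQuantumProb {U : TM} {t n : ℕ} {w c : List Bool}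
    (hw : w.length ≤ t) (h : ∀ r, U.eval t (ones n) (w ++ r) = some c) (x : List Bool) :
    QCircuit.runCode t c x / 2 ^ w.length ≤ universalQuantumProb U t n x := by
  obtain ⟨d, hd⟩ := Nat.exists_eq_add_of_le hw
  let g : List Bool → ℝ := fun p =>
    match U.eval t (ones n) p with
    | some c => QCircuit.runCode t c x
    | none => 0
  have hg : ∀ p, 0 ≤ g p := by
    intro p
    simp only [g]
    split
    · exact QCircuit.runCode_nonneg _ _ _
    · exact le_rfl
  have hgw : ∀ r, g (w ++ r) = QCircuit.runCode t c x := by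
    intro r
    simp only [g, h]
  have hsum : 2 ^ d * QCircuit.runCode t c x ≤ ∑ p : Fin t → Bool, g (List.ofFn p) := by
    clear_value g
    subst hd
    -- Split the random string after `|w|` bits and keep only the terms whose first part is `w`.
    rw [← (Fin.appendEquiv w.length d).sum_comp, Fintype.sum_prod_type]
    refine le_trans ?_ (Finset.single_le_sum (f := fun a : Fin w.length → Bool =>
      ∑ b : Fin d → Bool, g (List.ofFn (Fin.appendEquiv w.length d (a, b))))
      (fun a _ => Finset.sum_nonneg fun b _ => hg _) (Finset.mem_univ w.get))
    simp [Fin.appendEquiv, List.ofFn_fin_append, hgw]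
  calc QCircuit.runCode t c x / 2 ^ w.length
      = 2 ^ d * QCircuit.runCode t c x / 2 ^ t := by
        rw [hd, pow_add]; field_simp
    _ ≤ universalQuantumProb U t n x := div_le_div_of_nonneg_right hsum (by positivity)

/-! ## Complexities -/

theorem TM.IsUniversal.exists_quantumProb_le {U D : TM} {t₀ : Polynomial ℕ}
    (hU : U.IsUniversal t₀) {m T t : Polynomial ℕ} (hD : IsQuantumSampler D m T)
    (ht : ∀ n : ℕ, t₀.eval (n + T.eval n) ≤ t.eval n) :
    ∃ L : ℕ, ∀ n ≥ L, ∀ x, quantumProb D T n x / 2 ^ L ≤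
      universalQuantumProb U (t.eval n) n x := by
  obtain ⟨w, hw⟩ := hU.2 D
  refine ⟨w.length, fun n hn x => ?_⟩
  obtain ⟨C, -, hd, hC⟩ := hD n
  -- From `t₀(s) ≥ s`; this yields both that the circuit depth is at most `t(n)` and that the
  -- program fits into `t(n)` bits. The condition `n ≥ |w|` meets the length requirement of
  -- universality.
  have htn : n + T.eval n ≤ t.eval n := (hU.1 _).trans (ht n)
  have hlen : (ones n).length = n := by simp [ones]
  rw [quantumProb_eq_prob hd (hC []),
    ← QCircuit.runCode_encode (t := t.eval n) (by omega) x]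
  refine runCode_div_le_universalQuantumProb (by omega) (fun r => ?_) x
  have := hw (ones n) r C.encode (T.eval n) (by omega) (hC r)
  rw [hlen] at this
  exact TM.eval_mono (ht n) this

/-- The sampler is `TM.paddedRun D U` with `t(n)` coins, so that its clock allows exactly `t(n)`
steps of `U`. Runs that are cut off or padded can only add mass to strings of length `m(n)`. -/
theorem IsQuantumSampler.exists_isPPTSampler {D : TM} {m T : Polynomial ℕ}
    (hD : IsQuantumSampler D m T) (U : TM) (t : Polynomial ℕ) :
    ∃ (A : TM) (s : Polynomial ℕ), IsPPTSampler A m t s ∧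
      ∀ (n : ℕ) (x : Fin (m.eval n) → Bool),
        classicalProb U (t.eval n) (t.eval n) (ones n) (List.ofFn x) ≤
          classicalProb A (t.eval n) (s.eval n) (ones n) (List.ofFn x) := by
  refine ⟨TM.paddedRun D U, 2 * Polynomial.X + 3 * t + T + m + 5, ?_⟩
  have key : ∀ (n : ℕ) (r : Fin (t.eval n) → Bool), ∃ x : List Bool, x.length = m.eval n ∧
      (TM.paddedRun D U).eval ((2 * Polynomial.X + 3 * t + T + m + 5 : Polynomial ℕ).eval n)
        (ones n) (List.ofFn r) = some x ∧
      ∀ x' : List Bool, x'.length = m.eval n →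
        U.eval (t.eval n) (ones n) (List.ofFn r) = some x' → x' = x := by
    intro n r
    obtain ⟨C, hm, -, hC⟩ := hD n
    have h := TM.eval_paddedRun U (List.ofFn r) (hC [])
    rw [List.length_ofFn, hm] at h
    simpa [ones] using h
  refine ⟨fun n r => ?_, fun n x => classicalProb_le_classicalProb fun r hr => ?_⟩
  · obtain ⟨x, hx, h, -⟩ := key n r
    exact ⟨x, hx, h⟩
  · obtain ⟨z, -, h, hz⟩ := key n r
    rw [hz _ (by simp) hr]
    exact h

theorem IsStrongQAS.eventually_sum_le {D : TM} {m T : Polynomial ℕ} (hD : IsStrongQAS D m T)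
    (U : TM) (t : Polynomial ℕ) (L k c : ℕ) :
    ∀ᶠ n : ℕ in atTop, ∀ B : Finset (Fin (m.eval n) → Bool),
      (∀ x ∈ B, quantumProb D T n (List.ofFn x) / 2 ^ L ≤
        (n : ℝ) ^ k * classicalProb U (t.eval n) (t.eval n) (ones n) (List.ofFn x)) →
      ∑ x ∈ B, quantumProb D T n (List.ofFn x) ≤ 1 / (n : ℝ) ^ c := by
  obtain ⟨A, s, hA, hle⟩ := hD.1.exists_isPPTSampler U t
  -- In the exponent, `k` pays for the factor `n^k`, and the additional `1` pays for `2^L ≤ n`.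
  filter_upwards [hD.2 A t s hA (c + 1 + k), eventually_ge_atTop (2 ^ L)] with n hn hnL B hB
  have hn1 : 1 ≤ n := Nat.one_le_two_pow.trans hnL
  have hnR : (1 : ℝ) ≤ n := by exact_mod_cast hn1
  have hnL' : (2 : ℝ) ^ L ≤ n := by exact_mod_cast hnL
  have hnk : (1 : ℝ) ≤ (n : ℝ) ^ k := one_le_pow₀ hnR
  have hpos : (0 : ℝ) < 2 ^ L * (n : ℝ) ^ k := by positivity
  have h := (mul_sum_le_one_sub_statDist (δ := 1 / (2 ^ L * (n : ℝ) ^ k))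
    (quantumProb_nonneg D T n) (classicalProb_nonneg A (t.eval n) (s.eval n) (ones n))
    (hD.1.sum_quantumProb n) (sum_classicalProb_le_one _ _ _ _ _) ?_ B fun x hx => ?_).trans hn.le
  · rw [one_div_mul_eq_div, div_le_iff₀ hpos] at h
    calc _ ≤ _ := h
      _ = 2 ^ L / n * (1 / (n : ℝ) ^ c) := by
        rw [pow_add, pow_add, pow_one]; field_simp
      _ ≤ 1 / (n : ℝ) ^ c :=
        mul_le_of_le_one_left (by positivity) ((div_le_one (by positivity)).2 hnL')
  · rw [div_le_one hpos]
    exact one_le_mul_of_one_le_of_one_le (one_le_pow₀ (by norm_num)) hnk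
  · refine le_trans ?_ (hle n x)
    rw [one_div_mul_eq_div, div_le_iff₀ hpos]
    have := hB x hx
    rw [div_le_iff₀ (by positivity)] at this
    linarith

theorem quK_add_le_uK {U : TM} {t n k : ℕ} (hn : 1 ≤ n) {x : List Bool}
    (h : (n : ℝ) ^ k * classicalProb U t t (ones n) x ≤ universalQuantumProb U t n x) :
    quK U t x n + (((k : ℝ) * Real.logb 2 n : ℝ) : EReal) ≤ uK U t x (ones n) := by
  unfold quK uK negLogTwo
  by_cases h0 : classicalProb U t t (ones n) x = 0
  -- Here `uK` is `⊤`.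
  · simp [h0]
  · have hn' : (0 : ℝ) < n := by exact_mod_cast hn
    have hpos : 0 < classicalProb U t t (ones n) x :=
      (classicalProb_nonneg _ _ _ _ _).lt_of_ne' h0
    have hpos' : 0 < (n : ℝ) ^ k * classicalProb U t t (ones n) x := by positivity
    rw [if_neg h0, if_neg (hpos'.trans_le h).ne', ← EReal.coe_add, EReal.coe_le_coe_iff]
    have := Real.logb_le_logb_of_le (b := 2) (by norm_num) hpos' h
    rw [Real.logb_mul (by positivity) h0, Real.logb_pow] at this
    linarith

/-- Countably many properties that hold eventually hold along a sequence of indices that tends to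
infinity. -/
theorem exists_tendsto_eventually_diagonal {p : ℕ → ℕ → Prop} (h : ∀ k, ∀ᶠ n in atTop, p k n) :
    ∃ g : ℕ → ℕ, Tendsto g atTop atTop ∧ ∀ᶠ n in atTop, p (g n) n := by
  classical
  choose N hN using fun k => eventually_atTop.1 (h k)
  -- The largest `k ≤ n` whose threshold `N k` has been passed. The default value `0` of
  -- `Nat.findGreatest` is legitimate only from `N 0` on.
  refine ⟨fun n => Nat.findGreatest (fun k => N k ≤ n) n, tendsto_atTop.2 fun K => ?_, ?_⟩
  · filter_upwards [eventually_ge_atTop (max K (N K))] with n hn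
    exact Nat.le_findGreatest (le_trans (le_max_left _ _) hn) (le_trans (le_max_right _ _) hn)
  · filter_upwards [eventually_ge_atTop (N 0)] with n hn
    exact hN _ n (Nat.findGreatest_spec (P := fun k => N k ≤ n) (Nat.zero_le n) hn)

open Classical in
theorem mainTheorem9
    (U : TM) (t₀ : Polynomial ℕ) (hU : U.IsUniversal t₀)
    (D : TM) (m T : Polynomial ℕ) (hD : IsStrongQAS D m T)
    (c : ℝ) (t : Polynomial ℕ) (ht : ∀ n : ℕ, t₀.eval (n + T.eval n) ≤ t.eval n) :
    ∃ f : ℕ → ℝ, Tendsto (fun n : ℕ => f n / Real.log n) atTop atTop ∧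
      ∀ᶠ n : ℕ in atTop,
        1 - 1 / (n : ℝ) ^ c ≤
          ∑ x : Fin (m.eval n) → Bool,
            if quK U (t.eval n) (List.ofFn x) n + (f n : EReal)
                ≤ uK U (t.eval n) (List.ofFn x) (ones n)
              then quantumProb D T n (List.ofFn x) else 0 := by
  obtain ⟨L, hL⟩ := hU.exists_quantumProb_le hD.1 ht
  -- Negligibility is stated with natural exponents, so the real `c` is rounded up.
  obtain ⟨c', hc'⟩ := exists_nat_ge c
  obtain ⟨g, hg, hgp⟩ := exists_tendsto_eventually_diagonal
    fun k => hD.eventually_sum_le U t L k c'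
  refine ⟨fun n => g n * Real.logb 2 n, ?_, ?_⟩
  · have hlim : Tendsto (fun n => (g n : ℝ) / Real.log 2) atTop atTop :=
      (tendsto_natCast_atTop_atTop.comp hg).atTop_div_const (Real.log_pos one_lt_two)
    refine hlim.congr' ?_
    filter_upwards [eventually_ge_atTop 2] with n hn
    have : Real.log n ≠ 0 := (Real.log_pos (by exact_mod_cast hn)).ne'
    rw [Real.logb]
    field_simp
  · filter_upwards [hgp, eventually_ge_atTop L, eventually_ge_atTop 1] with n hn hnL hn1
    have hn1' : (1 : ℝ) ≤ n := by exact_mod_cast hn1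
    have hpow : 1 / (n : ℝ) ^ c' ≤ 1 / (n : ℝ) ^ c := by
      rw [← Real.rpow_natCast]
      exact one_div_le_one_div_of_le (by positivity) (Real.rpow_le_rpow_of_exponent_le hn1' hc')
    -- The bad strings are those to which `U` gives too much probability. Off this set, `n^(g n)
    -- Q(x) ≤ P(x) / 2^L`, which is at most the universal quantum probability, so the gap holds.
    have hbad := (hn (Finset.univ.filter fun x => quantumProb D T n (List.ofFn x) / 2 ^ L <
        (n : ℝ) ^ g n * classicalProb U (t.eval n) (t.eval n) (ones n) (List.ofFn x))
      fun x hx => (Finset.mem_filter.1 hx).2.le).trans hpow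
    rw [Finset.sum_filter] at hbad
    have hle : ∀ x : Fin (m.eval n) → Bool, quantumProb D T n (List.ofFn x) ≤
        (if quantumProb D T n (List.ofFn x) / 2 ^ L <
          (n : ℝ) ^ g n * classicalProb U (t.eval n) (t.eval n) (ones n) (List.ofFn x)
          then quantumProb D T n (List.ofFn x) else 0) +
        if quK U (t.eval n) (List.ofFn x) n + ((g n * Real.logb 2 n : ℝ) : EReal)
          ≤ uK U (t.eval n) (List.ofFn x) (ones n)
          then quantumProb D T n (List.ofFn x) else 0 := by
      intro x
      have h0 := quantumProb_nonneg D T n (List.ofFn x)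
      by_cases hx : quantumProb D T n (List.ofFn x) / 2 ^ L <
          (n : ℝ) ^ g n * classicalProb U (t.eval n) (t.eval n) (ones n) (List.ofFn x)
      · rw [if_pos hx]
        split_ifs <;> linarith
      · rw [if_neg hx, if_pos (quK_add_le_uK hn1 ((not_lt.1 hx).trans (hL n hnL _))), zero_add]
    have hsum := Finset.sum_le_sum fun x (_ : x ∈ Finset.univ) => hle x
    rw [hD.1.sum_quantumProb n, Finset.sum_add_distrib] at hsum
    linarith
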